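/- Let $\lambda=(\lambda_1,\dots,\lambda_d)$, $d\ge 1$, be a sequence of positive integers with sum $n$. Let $$\widetilde{\mathcal P}_{d+1}(\lambda)=\mathrm{conv}\{(x,\,x_1^2+\cdots+x_d^2) : x\in\mathbb Z^d,\ 0\le x_i\le\lambda_i \text{ for } 1\le i\le d\}\subset\mathbb R^{d+1},$$ and let $\pi:\widetilde{\mathcal P}_{d+1}(\lambda)\to[0,n]$, $\pi(x)=x_1+\cdots+x_d$. Let $$\Pi_d(\lambda)=\Big\{\tfrac1n\int_0^n\gamma(t)\,dt \;:\; \gamma:[0,n]\to\widetilde{\mathcal P}_{d+1}(\lambda)\text{ continuous},\ \pi\circ\gamma=\mathrm{id}\Big\}\subset\mathbb R^{d+1}$$ be the monotone path polytope of $\pi$. Let $\mathcal A_d(\lambda)$ be the arrangement in $\mathbb R^d$ of the hyperplanes $x_i-x_j=s$ for $1\le i<j\le d$ and integers $s$ with $-\lambda_i+1\le s\le\lambda_j-1$. Its cone $\mathbf c\mathcal A_d(\lambda)$ is the linear arrangement in $\mathbb R^{d+1}$ of the hyperplanes $x_i-x_j=s\,x_{d+1}$ (for the same $i,j,s$) and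 $x_{d+1}=0$. Choose a nonzero normal vector $v_H$ for each $H\in\mathbf c\mathcal A_d(\lambda)$ (the choice is arbitrary), let $Z[\mathbf c\mathcal A_d(\lambda)]=\sum_{H}[-v_H,v_H]$ be the associated zonotope, and let the polar complex $Z[\mathcal A_d(\lambda)]$ be the complex of its lower faces. Here the lower faces of a polytope $P\subset\mathbb R^{d+1}$ are the nonempty faces on which some linear functional $c(x)=a_1x_1+\cdots+a_{d+1}x_{d+1}$ with $a_{d+1}>0$ attains its minimum over $P$, and a lower vertex is a point that is a lower face by itself. Then the complex of all lower faces of $\Pi_d(\lambda)$ is combinatorially equivalent to $Z[\mathcal A_d(\lambda)]$, that is, the two sets of lower faces, ordered by inclusion, are isomorphic posets. In particular, the lower vertices of $\Pi_d(\lambda)$ are in bijection with the regions of $\mathcal A_d(\lambda)$, that is, with the connected components of the complement in $\mathbb R^d$ of the union of its hyperplanes. -/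

import Mathlib

open scoped Pointwise

noncomputable section

namespace MonotonePath

/-- The space `ℝ^{d+1}`, written as `ℝ^d × ℝ`: the second component is the last coordinate, and the
canonical projection is `Prod.fst`. -/
abbrev Space (d : ℕ) : Type := (Fin d → ℝ) × ℝ

/-- The box `B(lam) = {x | 0 ≤ x_i ≤ lam_i}`. -/
def box {d : ℕ} (lam : Fin d → ℕ) : Set (Fin d → ℝ) :=
  {x | ∀ i, 0 ≤ x i ∧ x i ≤ (lam i : ℝ)}

/-- The vertices of the pile of cubes: the integer points of the box. -/
def pileVertices {d : ℕ} (lam : Fin d → ℕ) : Set (Fin d → ℝ) :=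
  {x | x ∈ box lam ∧ ∀ i, ∃ k : ℤ, x i = (k : ℝ)}

/-- The lifted pile of cubes: the convex hull of the points `(x, x_1^2 + ... + x_d^2)`, where `x`
runs through the vertices of the pile of cubes. -/
def liftedPile {d : ℕ} (lam : Fin d → ℕ) : Set (Space d) :=
  convexHull ℝ ((fun x : Fin d → ℝ => ((x, ∑ i, x i ^ 2) : Space d)) '' pileVertices lam)

/-- The linear functional `π(x) = x_1 + ... + x_d` on `ℝ^{d+1}` (the last coordinate is ignored). -/
def coordSum (d : ℕ) : Space d →ₗ[ℝ] ℝ :=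
  (∑ i, LinearMap.proj i) ∘ₗ LinearMap.fst ℝ (Fin d → ℝ) ℝ

/-- `γ` is a section of the projection `p : P → p(P)`: a continuous map from the segment `p(P)`
to `P` with `p ∘ γ = id`. Only the values of `γ` on `p(P)` matter. -/
def IsSection {E : Type*} [NormedAddCommGroup E] [NormedSpace ℝ E]
    (P : Set E) (p : E →ₗ[ℝ] ℝ) (γ : ℝ → E) : Prop :=
  ContinuousOn γ (p '' P) ∧ ∀ t ∈ p '' P, γ t ∈ P ∧ p (γ t) = t

/-- The monotone path polytope of `p : P → Q = p(P)`, that is, the fiber polytope in the case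
of a one-dimensional `Q`: the set of the averages `(1 / vol Q) ∫_Q γ` of the sections `γ`. -/
def monotonePathPolytope {E : Type*} [NormedAddCommGroup E] [NormedSpace ℝ E]
    (P : Set E) (p : E →ₗ[ℝ] ℝ) : Set E :=
  {z | ∃ γ : ℝ → E, IsSection P p γ ∧
    z = (MeasureTheory.volume.real (p '' P))⁻¹ • ∫ t in p '' P, γ t}

/-- The polytope `Π_d(lam)`. -/
def pathPolytope {d : ℕ} (lam : Fin d → ℕ) : Set (Space d) :=
  monotonePathPolytope (liftedPile lam) (coordSum d)

/-- The (nonempty) lower faces of a polytope `P` in `ℝ^{d+1}`: the faces on which some linear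
functional with positive last coefficient attains its minimum over `P`. As a subtype of
`Set (Space d)` this is partially ordered by inclusion. -/
def lowerFaces {d : ℕ} (P : Set (Space d)) : Set (Set (Space d)) :=
  {F | F.Nonempty ∧ ∃ c : Space d →ₗ[ℝ] ℝ, 0 < c (0, 1) ∧ F = {x | x ∈ P ∧ ∀ y ∈ P, c x ≤ c y}}

/-- The lower vertices of `P`: the points that form a lower face by themselves. -/
def lowerVertices {d : ℕ} (P : Set (Space d)) : Set (Space d) :=
  {v | {v} ∈ lowerFaces P}

/-- The arrangement `A_d(lam)` of the hyperplanes `x_i - x_j = s` in `ℝ^d`, for `i < j` and integers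
`s` with `-lam_i + 1 ≤ s ≤ lam_j - 1`. -/
def deformedBraid {d : ℕ} (lam : Fin d → ℕ) : Set (Set (Fin d → ℝ)) :=
  {H | ∃ i j : Fin d, i < j ∧ ∃ s : ℤ, -(lam i : ℤ) + 1 ≤ s ∧ s ≤ (lam j : ℤ) - 1 ∧
    H = {x | x i - x j = (s : ℝ)}}

/-- The regions of an arrangement: the connected components of the complement of the union of
its hyperplanes. -/
def regions {V : Type*} [TopologicalSpace V] (A : Set (Set V)) : Set (Set V) :=
  {R | ∃ x ∈ (⋃₀ A)ᶜ, R = connectedComponentIn (⋃₀ A)ᶜ x}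

/-- The normal vector `e_i - e_j - s e_{d+1}` of the hyperplane `x_i - x_j = s x_{d+1}`, which is the
homogenization of the hyperplane `x_i - x_j = s`. -/
def coneNormal {d : ℕ} (i j : Fin d) (s : ℤ) : Space d :=
  (Pi.single i 1 - Pi.single j 1, -(s : ℝ))

/-- The polar zonotope, associated to the cone of `A_d(lam)`: the Minkowski sum of the segments
`[-v_H, v_H]`, one for each hyperplane `H` of the cone, where `v_H` is a normal vector of `H`.
The hyperplanes are `x_{d+1} = 0`, with normal vector `w₀ e_{d+1}`, and the homogenizations
`x_i - x_j = s x_{d+1}` of the hyperplanes of `A_d(lam)`, with normal vectors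
`w i j s • (e_i - e_j - s e_{d+1})`. The numbers `w₀` and `w i j s` are nonzero and otherwise
arbitrary: they describe the choice of the normal vectors. -/
def polarZonotope {d : ℕ} (lam : Fin d → ℕ) (w₀ : ℝ) (w : Fin d → Fin d → ℤ → ℝ) :
    Set (Space d) :=
  segment ℝ (-(w₀ • ((0, 1) : Space d))) (w₀ • ((0, 1) : Space d)) +
    ∑ i : Fin d, ∑ j ∈ Finset.Ioi i, ∑ s ∈ Finset.Icc (-(lam i : ℤ) + 1) ((lam j : ℤ) - 1),
      segment ℝ (-(w i j s • coneNormal i j s)) (w i j s • coneNormal i j s)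

end MonotonePath

end

noncomputable section

namespace MonotonePath

open Filter Topology

/-! A functional with positive last coefficient can be rescaled to `functional a`. The average of a
section lies on the corresponding face of the path polytope exactly when the section is minimal in
every fiber (`average_mem_face_iff`), so the face is governed by the minimal sections.

On the points `lift v` the functional is the separable sum of the convex functions `a i * v i + v i
^ 2`. The `k`-th unit step in direction `i` costs `a i + 2 * k - 1`, which increases with `k`. Hence
making the steps greedily, in order of cost, gives a minimal section. Its optimality is certified by
a multiplier: after the cost of the current step is subtracted from all `a j`, the section point
minimizes over the whole pile. The face therefore depends only on the weak order of the step costs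
(`face_pathPolytope_subset`, with the converse `step_le_of_face_subset`).

With coefficients `2 * a i`, comparing the steps `(i, k)` and `(j, l)` means taking the sign of `a i
- a j - (l - k)`, and `l - k` runs through exactly the integers that define the arrangement. Thus
inclusion of faces is the relation `SignLE` on sign vectors. The same relation describes inclusion
of lower faces of the polar zonotope, so the two posets agree. Point faces belong to generic `a`,
and their sign vectors are the regions. -/

/-- The face of `P` on which the linear functional `c` attains its minimum. -/
def face {E : Type*} [AddCommGroup E] [Module ℝ E] (c : E →ₗ[ℝ] ℝ) (P : Set E) : Set E :=
  {x | x ∈ P ∧ ∀ y ∈ P, c x ≤ c y}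

/-! ### Sections, their averages, and polygonal paths -/

section Paths

variable {E : Type*} [NormedAddCommGroup E] [NormedSpace ℝ E]

/-- The average of a section. -/
def average (P : Set E) (p : E →ₗ[ℝ] ℝ) (γ : ℝ → E) : E :=
  (MeasureTheory.volume.real (p '' P))⁻¹ • ∫ t in p '' P, γ t

theorem average_mem {P : Set E} {p : E →ₗ[ℝ] ℝ} {γ : ℝ → E} (h : IsSection P p γ) :
    average P p γ ∈ monotonePathPolytope P p := ⟨γ, h, rfl⟩

theorem apply_average [FiniteDimensional ℝ E] {P : Set E} {p : E →ₗ[ℝ] ℝ} {N : ℝ}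
    (hP : p '' P = Set.Icc 0 N) (c : E →ₗ[ℝ] ℝ) {γ : ℝ → E} (h : IsSection P p γ) :
    c (average P p γ) = (MeasureTheory.volume.real (p '' P))⁻¹ * ∫ t in p '' P, c (γ t) := by
  have : CompleteSpace E := FiniteDimensional.complete ℝ E
  have hi : MeasureTheory.IntegrableOn γ (p '' P) := by
    have := h.1
    rw [hP] at this ⊢
    exact this.integrableOn_Icc
  have := (LinearMap.toContinuousLinearMap c).integral_comp_comm hi
  simp only [LinearMap.coe_toContinuousLinearMap'] at this
  rw [average, map_smul, smul_eq_mul, this]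

/-- The average of a section lies on the `c`-minimal face of the monotone path polytope if and only
if the section is minimal on every fiber. -/
theorem average_mem_face_iff [FiniteDimensional ℝ E] {P : Set E} {p : E →ₗ[ℝ] ℝ} {N : ℝ}
    (hP : p '' P = Set.Icc 0 N) (hN : 0 < N) (c : E →ₗ[ℝ] ℝ) {γ₀ γ : ℝ → E}
    (h₀ : IsSection P p γ₀) (hmin : ∀ t ∈ Set.Icc 0 N, ∀ x ∈ P, p x = t → c (γ₀ t) ≤ c x)
    (h : IsSection P p γ) :
    average P p γ ∈ face c (monotonePathPolytope P p) ↔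
      ∀ t ∈ Set.Icc 0 N, c (γ t) = c (γ₀ t) := by
  have hc : Continuous c := LinearMap.continuous_of_finiteDimensional c
  have hvol : 0 < (MeasureTheory.volume.real (p '' P))⁻¹ := by
    rw [hP, Real.volume_real_Icc_of_le hN.le]; simpa using hN
  have hcont : ∀ {δ : ℝ → E}, IsSection P p δ → ContinuousOn (fun t => c (δ t)) (Set.Icc 0 N) :=
    fun hδ => hc.comp_continuousOn (hP ▸ hδ.1)
  have hle : ∀ {δ : ℝ → E}, IsSection P p δ → ∀ t ∈ Set.Icc 0 N, c (γ₀ t) ≤ c (δ t) :=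
    fun hδ t ht => hmin t ht _ (hδ.2 t (hP ▸ ht)).1 (hδ.2 t (hP ▸ ht)).2
  have hint : ∀ {δ : ℝ → E}, IsSection P p δ →
      ∫ t in Set.Icc 0 N, c (γ₀ t) ≤ ∫ t in Set.Icc 0 N, c (δ t) := fun hδ =>
    MeasureTheory.setIntegral_mono_on (hcont h₀).integrableOn_Icc (hcont hδ).integrableOn_Icc
      measurableSet_Icc (hle hδ)
  constructor
  · rintro ⟨-, hz⟩ t ht
    have h1 := hz _ (average_mem h₀)
    rw [apply_average hP c h, apply_average hP c h₀, mul_le_mul_iff_right₀ hvol, hP] at h1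
    -- The excess over `γ₀` is continuous and nonnegative, so a zero integral makes it vanish almost
    -- everywhere, and by continuity at every `t`.
    have h2 : ∫ t in Set.Icc 0 N, (c (γ t) - c (γ₀ t)) = 0 := by
      rw [MeasureTheory.integral_sub (hcont h).integrableOn_Icc (hcont h₀).integrableOn_Icc]
      linarith [hint h]
    rw [MeasureTheory.setIntegral_eq_zero_iff_of_nonneg_ae] at h2
    · have h3 := MeasureTheory.Measure.eqOn_Icc_of_ae_eq MeasureTheory.volume hN.ne h2
        ((hcont h).sub (hcont h₀)) continuousOn_const
      have := h3 ht
      simp only [Pi.zero_apply] at this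
      linarith
    · filter_upwards [MeasureTheory.ae_restrict_mem measurableSet_Icc] with s hs
      simpa using hle h s hs
    · exact ((hcont h).sub (hcont h₀)).integrableOn_Icc
  · intro heq
    refine ⟨average_mem h, ?_⟩
    rintro _ ⟨δ, hδ, rfl⟩
    change c (average P p γ) ≤ c (average P p δ)
    rw [apply_average hP c h, apply_average hP c hδ, mul_le_mul_iff_right₀ hvol, hP,
      MeasureTheory.setIntegral_congr_fun measurableSet_Icc heq]
    exact hint hδ

/-- The polygonal path through the points `q 0, …, q n`, at the times `0, …, n`. -/
def polygonalPath (q : ℕ → E) (n : ℕ) (t : ℝ) : E :=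
  q 0 + ∑ r ∈ Finset.range n, max 0 (min 1 (t - r)) • (q (r + 1) - q r)

theorem continuous_polygonalPath (q : ℕ → E) (n : ℕ) : Continuous (polygonalPath q n) := by
  unfold polygonalPath
  fun_prop

theorem polygonalPath_succ (q : ℕ → E) (n : ℕ) (t : ℝ) :
    polygonalPath q (n + 1) t =
      polygonalPath q n t + max 0 (min 1 (t - n)) • (q (n + 1) - q n) := by
  simp [polygonalPath, Finset.sum_range_succ, add_assoc]

theorem polygonalPath_of_le (q : ℕ → E) (n : ℕ) {t : ℝ} (ht : (n : ℝ) ≤ t) :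
    polygonalPath q n t = q n := by
  induction n with
  | zero => simp [polygonalPath]
  | succ n ih =>
    push_cast at ht
    rw [polygonalPath_succ, ih (by linarith), min_eq_left (by linarith), max_eq_right (by simp)]
    simp

theorem exists_polygonalPath_eq (q : ℕ → E) (n : ℕ) {t : ℝ} (hn : 0 < n) (h0 : 0 ≤ t)
    (ht : t ≤ n) : ∃ r < n, ∃ u : ℝ, 0 ≤ u ∧ u ≤ 1 ∧ t = r + u ∧
      polygonalPath q n t = (1 - u) • q r + u • q (r + 1) := by
  induction n with
  | zero => omega
  | succ n ih =>
    push_cast at ht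
    rw [polygonalPath_succ]
    rcases le_total (n : ℝ) t with h | h
    · refine ⟨n, by omega, t - n, by linarith, by linarith, by ring, ?_⟩
      rw [polygonalPath_of_le q n h, min_eq_right (by linarith), max_eq_right (by linarith)]
      module
    · rw [max_eq_left ((min_le_right _ _).trans (by linarith)), zero_smul, add_zero]
      rcases Nat.eq_zero_or_pos n with rfl | hn'
      · have : t = 0 := le_antisymm (by simpa using h) h0
        subst this
        exact ⟨0, by omega, 0, by simp, by simp, by simp, by simp [polygonalPath]⟩
      · obtain ⟨r, hr, u, hu⟩ := ih hn' h
        exact ⟨r, by omega, u, hu⟩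

end Paths

/-! ### Normalized functionals and the vertices of the lifted pile -/

/-- The linear functional `(x, h) ↦ a_1 x_1 + ⋯ + a_d x_d + h`. -/
def functional {d : ℕ} (a : Fin d → ℝ) : Space d →ₗ[ℝ] ℝ :=
  (∑ i, a i • LinearMap.proj i) ∘ₗ LinearMap.fst ℝ (Fin d → ℝ) ℝ +
    LinearMap.snd ℝ (Fin d → ℝ) ℝ

theorem functional_apply {d : ℕ} (a : Fin d → ℝ) (z : Space d) :
    functional a z = ∑ i, a i * z.1 i + z.2 := by
  simp [functional]

theorem coordSum_apply {d : ℕ} (z : Space d) : coordSum d z = ∑ i, z.1 i := by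
  simp [coordSum]

/-- Here `θ` is a Lagrange multiplier: on a fiber of `coordSum` the shift changes only a constant,
so a minimizer of the shifted functional over the whole pile is a minimizer over its fiber. -/
theorem functional_sub_const {d : ℕ} (a : Fin d → ℝ) (θ : ℝ) (z : Space d) :
    functional (fun i => a i - θ) z = functional a z - θ * coordSum d z := by
  simp only [functional_apply, coordSum_apply, sub_mul, Finset.sum_sub_distrib, Finset.mul_sum]
  ring

/-- The lifting of an integer point to the paraboloid. -/
def lift {d : ℕ} (v : Fin d → ℕ) : Space d := (fun i => (v i : ℝ), ∑ i, (v i : ℝ) ^ 2)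

theorem functional_lift {d : ℕ} (a : Fin d → ℝ) (v : Fin d → ℕ) :
    functional a (lift v) = ∑ i, (a i * v i + (v i : ℝ) ^ 2) := by
  rw [functional_apply, lift, Finset.sum_add_distrib]

theorem coordSum_lift {d : ℕ} (v : Fin d → ℕ) : coordSum d (lift v) = ((∑ i, v i : ℕ) : ℝ) := by
  simp [coordSum_apply, lift]

theorem liftedPile_eq {d : ℕ} (lam : Fin d → ℕ) :
    liftedPile lam = convexHull ℝ (lift '' Set.Iic lam) := by
  rw [liftedPile]
  congr 1
  ext z
  constructor
  · rintro ⟨x, ⟨hx, hk⟩, rfl⟩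
    choose k hk using hk
    have hk0 : ∀ i, 0 ≤ k i := fun i => by
      have := (hx i).1
      rw [hk] at this
      exact_mod_cast this
    have hki : ∀ i, (((k i).toNat : ℕ) : ℝ) = x i := fun i => by
      rw [hk]
      exact_mod_cast Int.toNat_of_nonneg (hk0 i)
    refine ⟨fun i => (k i).toNat, fun i => ?_, ?_⟩
    · have := (hx i).2
      rw [← hki] at this
      exact_mod_cast this
    · simp [lift, hki]
  · rintro ⟨v, hv, rfl⟩
    exact ⟨fun i => (v i : ℝ), ⟨fun i => ⟨by positivity, Nat.cast_le.2 (hv i)⟩,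
      fun i => ⟨v i, by simp⟩⟩, rfl⟩

theorem convex_liftedPile {d : ℕ} (lam : Fin d → ℕ) : Convex ℝ (liftedPile lam) :=
  convex_convexHull ℝ _

theorem lift_mem {d : ℕ} {lam v : Fin d → ℕ} (hv : v ≤ lam) : lift v ∈ liftedPile lam := by
  rw [liftedPile_eq]
  exact subset_convexHull ℝ _ ⟨v, hv, rfl⟩

theorem le_of_forall_lift {d : ℕ} {lam : Fin d → ℕ} {c : Space d →ₗ[ℝ] ℝ} {m : ℝ}
    (h : ∀ v ≤ lam, m ≤ c (lift v)) {x : Space d} (hx : x ∈ liftedPile lam) : m ≤ c x := by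
  rw [liftedPile_eq] at hx
  refine convexHull_min (t := {x | m ≤ c x}) ?_ (convex_halfSpace_ge c.isLinear m) hx
  rintro _ ⟨v, hv, rfl⟩
  exact h v hv

/-- A face of the lifted pile is determined by its vertices. -/
theorem face_subset_face {d : ℕ} {lam : Fin d → ℕ} {c c' : Space d →ₗ[ℝ] ℝ} {m m' : ℝ}
    (h : ∀ v ≤ lam, m ≤ c (lift v)) (h' : ∀ v ≤ lam, m' ≤ c' (lift v))
    (hh : ∀ v ≤ lam, c (lift v) = m → c' (lift v) = m')
    {x : Space d} (hx : x ∈ liftedPile lam) (hm : c x = m) : c' x = m' := by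
  -- There are finitely many vertices, and the slack of `c'` vanishes wherever that of `c` does. So
  -- a multiple of the slack of `c` dominates it, and this inequality extends to the hull.
  have key : ∃ K : ℝ, ∀ v ≤ lam, c' (lift v) - m' ≤ K * (c (lift v) - m) := by
    have hfin : (Set.Iic lam).Finite := Set.finite_Iic lam
    obtain ⟨K, hK⟩ := (hfin.image fun v => (c' (lift v) - m') / (c (lift v) - m)).bddAbove
    refine ⟨K, fun v hv => ?_⟩
    rcases (h v hv).eq_or_lt with h0 | h0
    · rw [hh v hv h0.symm, ← h0]; simp
    · exact (div_le_iff₀ (by linarith)).1 (hK ⟨v, hv, rfl⟩)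
  obtain ⟨K, hK⟩ := key
  have h1 : K * m - m' ≤ (K • c - c') x := by
    refine le_of_forall_lift (fun v hv => ?_) hx
    have := hK v hv
    simp only [LinearMap.sub_apply, LinearMap.smul_apply, smul_eq_mul]
    linarith
  have h2 := le_of_forall_lift h' hx
  simp only [LinearMap.sub_apply, LinearMap.smul_apply, smul_eq_mul, hm] at h1
  linarith

/-! ### Local optimality -/

/-- The local criterion for `lift v` to be a minimizer of `functional a` on the lifted pile. -/
def IsCritical {d : ℕ} (lam : Fin d → ℕ) (a : Fin d → ℝ) (v : Fin d → ℕ) : Prop :=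
  ∀ i, (1 ≤ v i → a i + 2 * v i ≤ 1) ∧ (v i < lam i → -1 ≤ a i + 2 * v i)

/-- Separable convexity makes the local test global: the last step made in each direction costs at
most zero and the next one at least zero. -/
theorem IsCritical.functional_le {d : ℕ} {lam : Fin d → ℕ} {a : Fin d → ℝ} {v : Fin d → ℕ}
    (hv : IsCritical lam a v) {u : Fin d → ℕ} (hu : u ≤ lam) :
    functional a (lift v) ≤ functional a (lift u) := by
  rw [functional_lift, functional_lift]
  refine Finset.sum_le_sum fun i _ => ?_
  have hui : u i ≤ lam i := hu i
  rcases lt_trichotomy (v i) (u i) with h | h | h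
  -- The summands differ by `(u i - v i) * (a i + u i + v i)`, and integrality gives `u i + v i ≥ 2
  -- * v i + 1`.
  · have h1 := (hv i).2 (by omega)
    have h2 : (v i : ℝ) + 1 ≤ u i := by exact_mod_cast h
    nlinarith
  · rw [h]
  · have h1 := (hv i).1 (by omega)
    have h2 : (u i : ℝ) + 1 ≤ v i := by exact_mod_cast h
    nlinarith

theorem IsCritical.functional_le_of_mem {d : ℕ} {lam : Fin d → ℕ} {a : Fin d → ℝ} {v : Fin d → ℕ}
    (hv : IsCritical lam a v) {x : Space d} (hx : x ∈ liftedPile lam) :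
    functional a (lift v) ≤ functional a x :=
  le_of_forall_lift (fun _ hu => hv.functional_le hu) hx

theorem functional_lift_update {d : ℕ} (a : Fin d → ℝ) (v : Fin d → ℕ) (i : Fin d) (m : ℕ) :
    functional a (lift (Function.update v i m)) - functional a (lift v) =
      (a i * m + (m : ℝ) ^ 2) - (a i * v i + (v i : ℝ) ^ 2) := by
  rw [functional_lift, functional_lift, ← Finset.sum_sub_distrib, Finset.sum_eq_single i]
  · simp
  · intro j _ hj
    simp [Function.update_of_ne hj]
  · simp

theorem isCritical_of_minimal {d : ℕ} {lam : Fin d → ℕ} {a : Fin d → ℝ} {v : Fin d → ℕ}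
    (hv : v ≤ lam) (h : ∀ u ≤ lam, functional a (lift v) ≤ functional a (lift u)) :
    IsCritical lam a v := by
  intro i
  have hvi : v i ≤ lam i := hv i
  constructor
  · intro h1
    have h2 := h (Function.update v i (v i - 1))
      (update_le_iff.2 ⟨by omega, fun j _ => hv j⟩)
    have h3 := functional_lift_update a v i (v i - 1)
    rw [Nat.cast_sub h1] at h3
    push_cast at h3
    nlinarith
  · intro h1
    have h2 := h (Function.update v i (v i + 1))
      (update_le_iff.2 ⟨by omega, fun j _ => hv j⟩)
    have h3 := functional_lift_update a v i (v i + 1)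
    push_cast at h3
    nlinarith

/-! ### The greedy lattice path -/

/-- The index of a cheapest step that is available at `v`. -/
def IsCheapest {d : ℕ} (lam : Fin d → ℕ) (a : Fin d → ℝ) (v : Fin d → ℕ) (i : Fin d) : Prop :=
  v i < lam i ∧ ∀ j, v j < lam j → a i + 2 * v i ≤ a j + 2 * v j

theorem exists_isCheapest {d : ℕ} {lam : Fin d → ℕ} (a : Fin d → ℝ) {v : Fin d → ℕ}
    (h : ∃ i, v i < lam i) : ∃ i, IsCheapest lam a v i := by
  obtain ⟨i, hi, hmin⟩ := Set.exists_min_image {i | v i < lam i} (fun i => a i + 2 * (v i : ℝ))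
    (Set.toFinite _) h
  exact ⟨i, hi, hmin⟩

open Classical in
/-- One greedy step. -/
def greedyStep {d : ℕ} (lam : Fin d → ℕ) (a : Fin d → ℝ) (v : Fin d → ℕ) : Fin d → ℕ :=
  if h : ∃ i, IsCheapest lam a v i then Function.update v h.choose (v h.choose + 1) else v

/-- The greedy lattice path. -/
def greedy {d : ℕ} (lam : Fin d → ℕ) (a : Fin d → ℝ) : ℕ → Fin d → ℕ
  | 0 => 0
  | r + 1 => greedyStep lam a (greedy lam a r)

theorem greedy_le {d : ℕ} (lam : Fin d → ℕ) (a : Fin d → ℝ) (r : ℕ) : greedy lam a r ≤ lam := by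
  induction r with
  | zero => exact fun i => Nat.zero_le _
  | succ r ih =>
    rw [greedy, greedyStep]
    split_ifs with h
    · exact update_le_iff.2 ⟨h.choose_spec.1, fun j _ => ih j⟩
    · exact ih

theorem sum_update_succ {d : ℕ} (v : Fin d → ℕ) (i : Fin d) :
    ∑ j, Function.update v i (v i + 1) j = ∑ j, v j + 1 := by
  rw [Finset.sum_update_of_mem (Finset.mem_univ i),
    ← Finset.add_sum_erase _ v (Finset.mem_univ i), Finset.sdiff_singleton_eq_erase]
  ring

theorem exists_greedy_succ {d : ℕ} {lam : Fin d → ℕ} (a : Fin d → ℝ) {r : ℕ}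
    (hs : ∑ i, greedy lam a r i < ∑ i, lam i) :
    ∃ i, IsCheapest lam a (greedy lam a r) i ∧
      greedy lam a (r + 1) = Function.update (greedy lam a r) i (greedy lam a r i + 1) := by
  have h : ∃ i, IsCheapest lam a (greedy lam a r) i := by
    obtain ⟨i, -, hi⟩ := Finset.exists_lt_of_sum_lt hs
    exact exists_isCheapest a ⟨i, hi⟩
  exact ⟨h.choose, h.choose_spec, by rw [greedy, greedyStep, dif_pos h]⟩

theorem sum_greedy {d : ℕ} {lam : Fin d → ℕ} (a : Fin d → ℝ) {r : ℕ} (hr : r ≤ ∑ i, lam i) :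
    ∑ i, greedy lam a r i = r := by
  induction r with
  | zero => simp [greedy]
  | succ r ih =>
    have h := ih (by omega)
    obtain ⟨i, -, hi⟩ := exists_greedy_succ a (r := r) (lam := lam) (by omega)
    rw [hi, sum_update_succ, h]

theorem greedy_succ {d : ℕ} {lam : Fin d → ℕ} (a : Fin d → ℝ) {r : ℕ} (hr : r < ∑ i, lam i) :
    ∃ i, IsCheapest lam a (greedy lam a r) i ∧
      greedy lam a (r + 1) = Function.update (greedy lam a r) i (greedy lam a r i + 1) :=
  exists_greedy_succ a (by rwa [sum_greedy a hr.le])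

/-- The steps made so far are not more expensive than the steps to come. -/
theorem greedy_exchange {d : ℕ} {lam : Fin d → ℕ} (a : Fin d → ℝ) {r : ℕ}
    (hr : r ≤ ∑ i, lam i) {i j : Fin d} (hi : 1 ≤ greedy lam a r i)
    (hj : greedy lam a r j < lam j) :
    a i + 2 * greedy lam a r i ≤ a j + 2 * greedy lam a r j + 2 := by
  induction r with
  | zero => simp [greedy] at hi
  | succ r ih =>
    obtain ⟨k, ⟨hk, hmin⟩, hv⟩ := greedy_succ a (r := r) (lam := lam) hr
    rw [hv] at hi hj ⊢
    have ih' := ih (by omega)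
    -- If the new step is in direction `i`, its being cheapest gives the bound; if it is in
    -- direction `j`, the next cost there only rises.
    by_cases hik : i = k <;> by_cases hjk : j = k
    · subst hik hjk
      linarith
    · subst hik
      rw [Function.update_of_ne hjk] at hj ⊢
      rw [Function.update_self]
      push_cast
      linarith [hmin j hj]
    · subst hjk
      rw [Function.update_of_ne hik] at hi ⊢
      rw [Function.update_self]
      push_cast
      linarith [ih' hi hk]
    · rw [Function.update_of_ne hik] at hi ⊢
      rw [Function.update_of_ne hjk] at hj ⊢
      exact ih' hi hj

/-- Both ends of a greedy step are minimizers of the functional for which that step costs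
nothing. -/
theorem isCritical_greedy {d : ℕ} {lam : Fin d → ℕ} (a : Fin d → ℝ) {r : ℕ}
    (hr : r < ∑ i, lam i) : ∃ (i : Fin d) (k : ℕ), 1 ≤ k ∧ k ≤ lam i ∧
      IsCritical lam (fun j => a j - (a i + 2 * k - 1)) (greedy lam a r) ∧
      IsCritical lam (fun j => a j - (a i + 2 * k - 1)) (greedy lam a (r + 1)) := by
  obtain ⟨i, ⟨hi, hmin⟩, hv⟩ := greedy_succ a hr
  refine ⟨i, greedy lam a r i + 1, by omega, hi, fun j => ⟨fun hj => ?_, fun hj => ?_⟩,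
    fun j => ⟨fun hj => ?_, fun hj => ?_⟩⟩
  · have := greedy_exchange a hr.le hj hi
    push_cast
    linarith
  · have := hmin j hj
    push_cast
    linarith
  · rw [hv] at hj ⊢
    rcases eq_or_ne j i with rfl | h
    · rw [Function.update_self]
      push_cast
      linarith
    · rw [Function.update_of_ne h] at hj ⊢
      have := greedy_exchange a hr.le hj hi
      push_cast
      linarith
  · rw [hv] at hj ⊢
    rcases eq_or_ne j i with rfl | h
    · rw [Function.update_self]
      push_cast
      linarith
    · rw [Function.update_of_ne h] at hj ⊢
      have := hmin j hj
      push_cast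
      linarith

/-- At the time when the step `(i, k)` is made, no strictly more expensive step has been made. -/
theorem exists_greedy_separating {d : ℕ} {lam : Fin d → ℕ} (a : Fin d → ℝ) {i j : Fin d} {k l : ℕ}
    (hk : k ≤ lam i) (hl : 1 ≤ l) (hlt : a i + 2 * k < a j + 2 * l) :
    ∃ r ≤ ∑ i, lam i, k ≤ greedy lam a r i ∧ greedy lam a r j < l := by
  have hex : ∃ r, r ≤ ∑ i, lam i ∧ k ≤ greedy lam a r i := by
    refine ⟨_, le_rfl, ?_⟩
    have h1 := sum_greedy (lam := lam) a le_rfl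
    have h2 := (Finset.sum_eq_sum_iff_of_le fun i _ => greedy_le lam a (∑ i, lam i) i).1 h1 i
      (Finset.mem_univ i)
    omega
  classical
  -- Take the first time at which `(i, k)` has been made. Just before a positive such time it was a
  -- cheapest available step, so `greedy_exchange` excludes an earlier, strictly dearer `(j, l)`.
  obtain ⟨hr, hrk⟩ := Nat.find_spec hex
  refine ⟨_, hr, hrk, ?_⟩
  rcases h : Nat.find hex with _ | r
  · simpa [greedy] using Nat.pos_of_ne_zero (by omega)
  · have hnot := Nat.find_min hex (m := r) (by omega)
    rw [h] at hr hrk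
    have hri : greedy lam a r i < k := by
      by_contra hcon
      exact hnot ⟨by omega, by omega⟩
    obtain ⟨m, ⟨hm, hmin⟩, hv⟩ := greedy_succ a (r := r) (lam := lam) hr
    rw [hv] at hrk ⊢
    have hmi : m = i := by
      by_contra hcon
      rw [Function.update_of_ne (Ne.symm hcon)] at hrk
      omega
    subst hmi
    rw [Function.update_self] at hrk
    have hkr : greedy lam a r m + 1 = k := by omega
    have hkr' : (greedy lam a r m : ℝ) + 1 = k := by exact_mod_cast hkr
    rcases eq_or_ne j m with rfl | hjm
    · rw [Function.update_self, hkr]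
      have : (k : ℝ) < l := by linarith
      exact_mod_cast this
    · rw [Function.update_of_ne hjm]
      by_contra hcon
      push Not at hcon
      have h1 := greedy_exchange a (by omega) (hl.trans hcon) hm
      have h2 : (l : ℝ) ≤ greedy lam a r j := by exact_mod_cast hcon
      linarith

/-! ### Minimality of the greedy section -/

/-- The greedy section of the lifted pile. -/
def greedySection {d : ℕ} (lam : Fin d → ℕ) (a : Fin d → ℝ) : ℝ → Space d :=
  polygonalPath (fun r => lift (greedy lam a r)) (∑ i, lam i)

/-- Each point of the section lies on a segment with both ends critical for the same shifted
functional. The data `i`, `k`, `v` certify its optimality, with the cost of `(i, k)` as multiplier.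
-/
theorem greedySection_spec {d : ℕ} {lam : Fin d → ℕ} (hn : 0 < ∑ i, lam i) (a : Fin d → ℝ)
    {t : ℝ} (ht : t ∈ Set.Icc (0 : ℝ) (∑ i, lam i : ℕ)) :
    greedySection lam a t ∈ liftedPile lam ∧ coordSum d (greedySection lam a t) = t ∧
    ∃ (i : Fin d) (k : ℕ), 1 ≤ k ∧ k ≤ lam i ∧ ∃ v ≤ lam,
      IsCritical lam (fun j => a j - (a i + 2 * k - 1)) v ∧
      functional (fun j => a j - (a i + 2 * k - 1)) (greedySection lam a t) =
        functional (fun j => a j - (a i + 2 * k - 1)) (lift v) := by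
  obtain ⟨r, hr, u, hu0, hu1, htu, heq⟩ := exists_polygonalPath_eq
    (fun r => lift (greedy lam a r)) (∑ i, lam i) hn ht.1 ht.2
  obtain ⟨i, k, hk1, hk, hc, hc'⟩ := isCritical_greedy a hr
  rw [greedySection, heq]
  refine ⟨convex_liftedPile lam (lift_mem (greedy_le lam a r)) (lift_mem (greedy_le lam a (r + 1)))
    (by linarith) hu0 (by ring), ?_, i, k, hk1, hk, _, greedy_le lam a r, hc, ?_⟩
  · rw [map_add, map_smul, map_smul, coordSum_lift, coordSum_lift, sum_greedy a hr.le,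
      sum_greedy a hr, htu]
    push_cast
    simp only [smul_eq_mul]
    ring
  · have := le_antisymm (hc.functional_le (greedy_le lam a (r + 1)))
      (hc'.functional_le (greedy_le lam a r))
    rw [map_add, map_smul, map_smul, ← this]
    simp only [smul_eq_mul]
    ring

theorem coordSum_image_liftedPile {d : ℕ} {lam : Fin d → ℕ} (hn : 0 < ∑ i, lam i) :
    coordSum d '' liftedPile lam = Set.Icc (0 : ℝ) (∑ i, lam i : ℕ) := by
  apply Set.Subset.antisymm
  · rintro _ ⟨x, hx, rfl⟩
    constructor
    · refine le_of_forall_lift (fun v _ => ?_) hx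
      rw [coordSum_lift]
      positivity
    · have := le_of_forall_lift (c := -coordSum d) (m := -((∑ i, lam i : ℕ) : ℝ))
        (fun v hv => ?_) hx
      · simpa using this
      · rw [LinearMap.neg_apply, coordSum_lift, neg_le_neg_iff]
        exact_mod_cast Finset.sum_le_sum fun i _ => hv i
  · intro t ht
    obtain ⟨h1, h2, -⟩ := greedySection_spec hn 0 ht
    exact ⟨_, h1, h2⟩

theorem isSection_greedySection {d : ℕ} {lam : Fin d → ℕ} (hn : 0 < ∑ i, lam i)
    (a : Fin d → ℝ) : IsSection (liftedPile lam) (coordSum d) (greedySection lam a) := by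
  refine ⟨(continuous_polygonalPath _ _).continuousOn, fun t ht => ?_⟩
  rw [coordSum_image_liftedPile hn] at ht
  obtain ⟨h1, h2, -⟩ := greedySection_spec hn a ht
  exact ⟨h1, h2⟩

theorem greedySection_minimal {d : ℕ} {lam : Fin d → ℕ} (hn : 0 < ∑ i, lam i) (a : Fin d → ℝ)
    {t : ℝ} (ht : t ∈ Set.Icc (0 : ℝ) (∑ i, lam i : ℕ)) {x : Space d} (hx : x ∈ liftedPile lam)
    (hxt : coordSum d x = t) : functional a (greedySection lam a t) ≤ functional a x := by
  obtain ⟨-, h2, i, k, -, -, v, -, hv, h⟩ := greedySection_spec hn a ht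
  have := hv.functional_le_of_mem hx
  rw [← h, functional_sub_const, functional_sub_const, h2, hxt] at this
  linarith

/-! ### Faces of the path polytope and the order of step costs -/

/-- The order of the step costs given by `b` is weakly compatible with the one given by `a`. -/
def StepOrderLE {d : ℕ} (lam : Fin d → ℕ) (a b : Fin d → ℝ) : Prop :=
  ∀ (i j : Fin d) (k l : ℕ), 1 ≤ k → k ≤ lam i → 1 ≤ l → l ≤ lam j →
    a i + 2 * k ≤ a j + 2 * l → b i + 2 * k ≤ b j + 2 * l

/-- Criticality with this multiplier only compares other steps with `(i, k)`: those made are no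
dearer, the next ones no cheaper. -/
theorem IsCritical.of_stepOrderLE {d : ℕ} {lam : Fin d → ℕ} {a b : Fin d → ℝ}
    (hab : StepOrderLE lam a b) {i : Fin d} {k : ℕ} (hk1 : 1 ≤ k) (hk : k ≤ lam i)
    {v : Fin d → ℕ} (hvl : v ≤ lam) (hv : IsCritical lam (fun j => a j - (a i + 2 * k - 1)) v) :
    IsCritical lam (fun j => b j - (b i + 2 * k - 1)) v := by
  refine fun j => ⟨fun hj => ?_, fun hj => ?_⟩
  · have h1 := (hv j).1 hj
    have := hab j i (v j) k hj (hvl j) hk1 hk (by linarith)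
    linarith
  · have h1 := (hv j).2 hj
    have := hab i j k (v j + 1) hk1 hk (by omega) hj (by push_cast; linarith)
    push_cast at this
    linarith

/-- A face of the path polytope shrinks if the order of the step costs is refined. -/
theorem face_pathPolytope_subset {d : ℕ} {lam : Fin d → ℕ} (hn : 0 < ∑ i, lam i)
    {a b : Fin d → ℝ} (hab : StepOrderLE lam a b) :
    face (functional a) (pathPolytope lam) ⊆ face (functional b) (pathPolytope lam) := by
  rintro z hz
  obtain ⟨γ, hγ, rfl⟩ := hz.1
  have hP := coordSum_image_liftedPile hn
  have hn' : (0 : ℝ) < (∑ i, lam i : ℕ) := by exact_mod_cast hn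
  refine (average_mem_face_iff hP hn' _ (isSection_greedySection hn b)
    (fun t ht x hx => greedySection_minimal hn b ht hx) hγ).2 fun t ht => ?_
  have hza := (average_mem_face_iff hP hn' _ (isSection_greedySection hn a)
    (fun t ht x hx => greedySection_minimal hn a ht hx) hγ).1 hz t ht
  obtain ⟨-, h2, i, k, hk1, hk, v, hvl, hv, h⟩ := greedySection_spec hn a ht
  obtain ⟨g1, g2⟩ := hγ.2 t (hP ▸ ht)
  obtain ⟨f1, f2⟩ := (isSection_greedySection hn b).2 t (hP ▸ ht)
  have hvb := hv.of_stepOrderLE hab hk1 hk hvl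
  -- Every vertex minimal for the shifted `a` is critical, hence also minimal for the shifted `b`;
  -- so the face containing `γ t` passes from `a` to `b`.
  have key := face_subset_face (fun u hu => hv.functional_le hu)
    (fun u hu => hvb.functional_le hu) (fun u hu huv => ?_) g1
    (m := functional (fun j => a j - (a i + 2 * k - 1)) (lift v)) ?_
  · have h3 := hvb.functional_le_of_mem f1
    rw [← key, functional_sub_const, functional_sub_const, g2, f2] at h3
    exact le_antisymm (by linarith) (greedySection_minimal hn b ht g1 g2)
  · have hu' : IsCritical lam (fun j => a j - (a i + 2 * k - 1)) u :=
      isCritical_of_minimal hu fun w hw => huv ▸ hv.functional_le hw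
    exact le_antisymm ((hu'.of_stepOrderLE hab hk1 hk hu).functional_le hvl)
      (hvb.functional_le hu)
  · rw [← h, functional_sub_const, functional_sub_const, h2, g2, hza]

theorem average_greedySection_mem {d : ℕ} {lam : Fin d → ℕ} (hn : 0 < ∑ i, lam i)
    (a : Fin d → ℝ) : average (liftedPile lam) (coordSum d) (greedySection lam a) ∈
      face (functional a) (pathPolytope lam) :=
  (average_mem_face_iff (coordSum_image_liftedPile hn) (by exact_mod_cast hn) _
    (isSection_greedySection hn a) (fun _ ht _ hx => greedySection_minimal hn a ht hx)
    (isSection_greedySection hn a)).2 fun _ _ => rfl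

theorem polygonalPath_natCast {E : Type*} [NormedAddCommGroup E] [NormedSpace ℝ E] (q : ℕ → E)
    {n r : ℕ} (hr : r ≤ n) : polygonalPath q n r = q r := by
  induction n with
  | zero => simp [polygonalPath, Nat.le_zero.1 hr]
  | succ n ih =>
    rcases Nat.lt_or_ge n r with h | h
    · obtain rfl : r = n + 1 := by omega
      exact polygonalPath_of_le q _ le_rfl
    · have h' : (r : ℝ) - n ≤ 0 := sub_nonpos.2 (by exact_mod_cast h)
      rw [polygonalPath_succ, ih h, max_eq_left ((min_le_right _ _).trans h'), zero_smul, add_zero]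

/-- At a time when the `a`-greedy path has made `(i, k)` but not `(j, l)`, its vertex is also
`b`-minimal in the fiber. The `b`-multiplier at that time then separates the two costs. -/
theorem step_le_of_face_subset {d : ℕ} {lam : Fin d → ℕ} (hn : 0 < ∑ i, lam i)
    {a b : Fin d → ℝ}
    (h : face (functional a) (pathPolytope lam) ⊆ face (functional b) (pathPolytope lam))
    {i j : Fin d} {k l : ℕ} (hk1 : 1 ≤ k) (hk : k ≤ lam i) (hl1 : 1 ≤ l) (hl : l ≤ lam j)
    (hlt : a i + 2 * k < a j + 2 * l) : b i + 2 * k ≤ b j + 2 * l := by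
  obtain ⟨r, hr, hri, hrj⟩ := exists_greedy_separating a hk hl1 hlt
  have ht : (r : ℝ) ∈ Set.Icc (0 : ℝ) (∑ i, lam i : ℕ) :=
    ⟨by positivity, by exact_mod_cast hr⟩
  have heq := (average_mem_face_iff (coordSum_image_liftedPile hn) (by exact_mod_cast hn) _
    (isSection_greedySection hn b) (fun _ ht _ hx => greedySection_minimal hn b ht hx)
    (isSection_greedySection hn a)).1 (h (average_greedySection_mem hn a)) r ht
  obtain ⟨-, h2, i', k', -, -, v, hvl, hv, h3⟩ := greedySection_spec hn b ht
  obtain ⟨-, h2', -⟩ := greedySection_spec hn a ht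
  have h4 : functional (fun j => b j - (b i' + 2 * k' - 1)) (lift (greedy lam a r)) =
      functional (fun j => b j - (b i' + 2 * k' - 1)) (lift v) := by
    rw [← h3, functional_sub_const, functional_sub_const, h2, ← heq, greedySection,
      polygonalPath_natCast _ hr, coordSum_lift, sum_greedy a hr]
  have hc := isCritical_of_minimal (greedy_le lam a r) fun u hu => h4 ▸ hv.functional_le hu
  have c1 := (hc i).1 (hk1.trans hri)
  have c2 := (hc j).2 (hrj.trans_le hl)
  have e1 : (k : ℝ) ≤ greedy lam a r i := by exact_mod_cast hri
  have e2 : (greedy lam a r j : ℝ) + 1 ≤ l := by exact_mod_cast hrj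
  linarith

/-! ### Faces of zonotopes -/

section Zonotope

variable {E ι : Type*} [AddCommGroup E] [Module ℝ E]

theorem mem_segment_neg_iff {v z : E} :
    z ∈ segment ℝ (-v) v ↔ ∃ t : ℝ, |t| ≤ 1 ∧ z = t • v := by
  rw [segment_eq_image]
  constructor
  · rintro ⟨θ, ⟨h0, h1⟩, rfl⟩
    exact ⟨2 * θ - 1, abs_le.2 ⟨by linarith, by linarith⟩, by module⟩
  · rintro ⟨t, ht, rfl⟩
    obtain ⟨h0, h1⟩ := abs_le.1 ht
    exact ⟨(t + 1) / 2, ⟨by linarith, by linarith⟩, by module⟩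

/-- The zonotope generated by the vectors `v h`, `h ∈ T`. -/
def zonotope (T : Finset ι) (v : ι → E) : Set E := ∑ h ∈ T, segment ℝ (-v h) (v h)

theorem mem_zonotope_iff {T : Finset ι} {v : ι → E} {z : E} :
    z ∈ zonotope T v ↔ ∃ t : ι → ℝ, (∀ h ∈ T, |t h| ≤ 1) ∧ z = ∑ h ∈ T, t h • v h := by
  rw [zonotope, Set.mem_finsetSum]
  constructor
  · rintro ⟨g, hg, rfl⟩
    have hg' : ∀ h, ∃ t : ℝ, h ∈ T → |t| ≤ 1 ∧ g h = t • v h := fun h => by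
      by_cases hh : h ∈ T
      · obtain ⟨t, ht⟩ := mem_segment_neg_iff.1 (hg hh)
        exact ⟨t, fun _ => ht⟩
      · exact ⟨0, fun h => absurd h hh⟩
    choose t ht using hg'
    exact ⟨t, fun h hh => (ht h hh).1, Finset.sum_congr rfl fun h hh => (ht h hh).2⟩
  · rintro ⟨t, ht, rfl⟩
    exact ⟨fun h => t h • v h, fun {h} hh => mem_segment_neg_iff.2 ⟨t h, ht h hh, rfl⟩, rfl⟩

theorem neg_abs_le_mul {t c : ℝ} (ht : |t| ≤ 1) : -|c| ≤ t * c := by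
  have h : |t * c| ≤ |c| := by
    rw [abs_mul]
    exact mul_le_of_le_one_left (abs_nonneg c) ht
  exact (abs_le.1 h).1

/-- A coefficient of absolute value at most one that detects the sign of `c`. -/
theorem exists_mul_eq_neg_abs (c : ℝ) : ∃ t : ℝ, |t| ≤ 1 ∧ t * c = -|c| ∧
    ∀ c', t * c' = -|c'| ↔ (0 ≤ c → 0 ≤ c') ∧ (c ≤ 0 → c' ≤ 0) := by
  rcases lt_trichotomy c 0 with h | rfl | h
  · refine ⟨1, by simp, by rw [abs_of_neg h]; ring, fun c' => ?_⟩
    rw [one_mul, eq_neg_iff_add_eq_zero]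
    constructor
    · intro h'
      exact ⟨fun h0 => by linarith, fun _ => by linarith [abs_nonneg c']⟩
    · intro h'
      rw [abs_of_nonpos (h'.2 h.le)]
      ring
  · refine ⟨0, by simp, by simp, fun c' => ?_⟩
    rw [zero_mul, eq_comm, neg_eq_zero, abs_eq_zero]
    constructor
    · rintro rfl
      simp
    · intro h'
      exact le_antisymm (h'.2 le_rfl) (h'.1 le_rfl)
  · refine ⟨-1, by simp, by rw [abs_of_pos h]; ring, fun c' => ?_⟩
    rw [neg_one_mul, neg_inj]
    constructor
    · intro h'
      exact ⟨fun _ => by linarith [abs_nonneg c'], fun h0 => by linarith⟩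
    · intro h'
      rw [abs_of_nonneg (h'.1 h.le)]

/-- The functional is a sum over the generators, so it is minimal exactly when every term attains
its own minimum. -/
theorem mem_face_zonotope_iff {T : Finset ι} {v : ι → E} (c : E →ₗ[ℝ] ℝ) {t : ι → ℝ}
    (ht : ∀ h ∈ T, |t h| ≤ 1) : ∑ h ∈ T, t h • v h ∈ face c (zonotope T v) ↔
      ∀ h ∈ T, t h * c (v h) = -|c (v h)| := by
  have hle : ∀ {s : ι → ℝ}, (∀ h ∈ T, |s h| ≤ 1) → ∀ h ∈ T, -|c (v h)| ≤ s h * c (v h) :=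
    fun hs h hh => neg_abs_le_mul (hs h hh)
  have hval : ∀ s : ι → ℝ, c (∑ h ∈ T, s h • v h) = ∑ h ∈ T, s h * c (v h) := by simp
  constructor
  · rintro ⟨-, hmin⟩
    choose s hs hs' _ using fun h => exists_mul_eq_neg_abs (c (v h))
    have h1 := hmin _ (mem_zonotope_iff.2 ⟨s, fun h _ => hs h, rfl⟩)
    rw [hval, hval, Finset.sum_congr rfl fun h _ => hs' h] at h1
    intro h hh
    exact ((Finset.sum_eq_sum_iff_of_le (hle ht)).1
      (le_antisymm (Finset.sum_le_sum (hle ht)) h1) h hh).symm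
  · intro heq
    refine ⟨mem_zonotope_iff.2 ⟨t, ht, rfl⟩, fun y hy => ?_⟩
    obtain ⟨s, hs, rfl⟩ := mem_zonotope_iff.1 hy
    rw [hval, hval, Finset.sum_congr rfl heq]
    exact Finset.sum_le_sum (hle hs)

theorem face_zonotope_nonempty (T : Finset ι) (v : ι → E) (c : E →ₗ[ℝ] ℝ) :
    (face c (zonotope T v)).Nonempty := by
  choose s hs hs' _ using fun h => exists_mul_eq_neg_abs (c (v h))
  exact ⟨_, (mem_face_zonotope_iff c fun h _ => hs h).2 fun h _ => hs' h⟩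

/-- Inclusion of faces of a zonotope in terms of the signs of the functionals on the generators. -/
theorem face_zonotope_subset_iff (T : Finset ι) (v : ι → E) (c c' : E →ₗ[ℝ] ℝ) :
    face c (zonotope T v) ⊆ face c' (zonotope T v) ↔
      ∀ h ∈ T, (0 ≤ c (v h) → 0 ≤ c' (v h)) ∧ (c (v h) ≤ 0 → c' (v h) ≤ 0) := by
  constructor
  · intro hsub h hh
    -- The coefficient is `0` where `c (v h) = 0`; this point in the relative interior of the face
    -- also detects the zero signs.
    choose s hs hs' hs'' using fun h => exists_mul_eq_neg_abs (c (v h))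
    have hmem := hsub ((mem_face_zonotope_iff c fun h _ => hs h).2 fun h _ => hs' h)
    exact (hs'' h _).1 ((mem_face_zonotope_iff c' fun h _ => hs h).1 hmem h hh)
  · rintro hsign z hz
    obtain ⟨t, ht, rfl⟩ := mem_zonotope_iff.1 hz.1
    rw [mem_face_zonotope_iff c ht] at hz
    rw [mem_face_zonotope_iff c' ht]
    intro h hh
    have h1 := hz h hh
    obtain ⟨h2, h3⟩ := hsign h hh
    rcases lt_trichotomy (c (v h)) 0 with h0 | h0 | h0
    · have h4 : t h = 1 := by
        rw [abs_of_neg h0, neg_neg] at h1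
        exact mul_right_cancel₀ h0.ne (by rw [h1, one_mul])
      rw [h4, abs_of_nonpos (h3 h0.le)]
      ring
    · rw [le_antisymm (h3 h0.le) (h2 h0.ge)]
      simp
    · have h4 : t h = -1 := by
        rw [abs_of_pos h0] at h1
        exact mul_right_cancel₀ h0.ne' (by rw [h1]; ring)
      rw [h4, abs_of_nonneg (h2 h0.le)]
      ring

end Zonotope

/-! ### Sign vectors of the arrangement -/

/-- The sign vector of `b` with respect to the arrangement is obtained from the one of `a` by
replacing some entries by zero. -/
def SignLE {d : ℕ} (lam : Fin d → ℕ) (b a : Fin d → ℝ) : Prop :=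
  ∀ i j : Fin d, i < j → ∀ s : ℤ, -(lam i : ℤ) + 1 ≤ s → s ≤ (lam j : ℤ) - 1 →
    (0 ≤ a i - a j - s → 0 ≤ b i - b j - s) ∧ (a i - a j - s ≤ 0 → b i - b j - s ≤ 0)

theorem functional_coneNormal {d : ℕ} (a : Fin d → ℝ) (i j : Fin d) (s : ℤ) :
    functional a (coneNormal i j s) = a i - a j - s := by
  rw [functional_apply, coneNormal]
  simp [mul_sub, Finset.sum_sub_distrib, Pi.single_apply]
  ring

/-- The generators of the polar zonotope. -/
def generator {d : ℕ} (w₀ : ℝ) (w : Fin d → Fin d → ℤ → ℝ) :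
    Option ((_ : Fin d) × (_ : Fin d) × ℤ) → Space d
  | none => w₀ • (0, 1)
  | some ⟨i, j, s⟩ => w i j s • coneNormal i j s

/-- The index set of the hyperplanes of the cone of the arrangement. -/
def coneIndex {d : ℕ} (lam : Fin d → ℕ) : Finset (Option ((_ : Fin d) × (_ : Fin d) × ℤ)) :=
  Finset.insertNone (Finset.univ.sigma fun i => (Finset.Ioi i).sigma fun j =>
    Finset.Icc (-(lam i : ℤ) + 1) ((lam j : ℤ) - 1))

theorem polarZonotope_eq {d : ℕ} (lam : Fin d → ℕ) (w₀ : ℝ) (w : Fin d → Fin d → ℤ → ℝ) :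
    polarZonotope lam w₀ w = zonotope (coneIndex lam) (generator w₀ w) := by
  rw [polarZonotope, zonotope, coneIndex, Finset.sum_insertNone, Finset.sum_sigma]
  simp only [Finset.sum_sigma, generator]

/-- A negative factor merely swaps the two implications, which is why the choice of normal vectors
is immaterial. -/
theorem sign_mul_iff {w x y : ℝ} (hw : w ≠ 0) :
    ((0 ≤ w * x → 0 ≤ w * y) ∧ (w * x ≤ 0 → w * y ≤ 0)) ↔
      ((0 ≤ x → 0 ≤ y) ∧ (x ≤ 0 → y ≤ 0)) := by
  have hpos : ∀ {r : ℝ}, 0 < r → ∀ u : ℝ, (0 ≤ r * u ↔ 0 ≤ u) ∧ (r * u ≤ 0 ↔ u ≤ 0) :=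
    fun hr u => ⟨mul_nonneg_iff_of_pos_left hr, mul_nonpos_iff_pos_imp_nonpos.trans
      ⟨fun h => h.1 hr, fun h => ⟨fun _ => h, fun _ => hr.le⟩⟩⟩
  rcases hw.lt_or_gt with h | h
  · have h' := hpos (neg_pos.2 h)
    simp only [neg_mul, Left.nonneg_neg_iff, Left.neg_nonpos_iff] at h'
    rw [(h' x).1, (h' x).2, (h' y).1, (h' y).2]
    exact and_comm
  · rw [(hpos h x).1, (hpos h x).2, (hpos h y).1, (hpos h y).2]

theorem face_polarZonotope_subset_iff {d : ℕ} (lam : Fin d → ℕ) {w₀ : ℝ}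
    {w : Fin d → Fin d → ℤ → ℝ} (hw : ∀ i j s, w i j s ≠ 0) (a b : Fin d → ℝ) :
    face (functional a) (polarZonotope lam w₀ w) ⊆ face (functional b) (polarZonotope lam w₀ w) ↔
      SignLE lam b a := by
  rw [polarZonotope_eq, face_zonotope_subset_iff]
  constructor
  · intro h i j hij s h1 h2
    have := h (some ⟨i, j, s⟩) (by simp [coneIndex, hij]; omega)
    simp only [generator, map_smul, smul_eq_mul, functional_coneNormal] at this
    exact (sign_mul_iff (hw i j s)).1 this
  · rintro h (_ | ⟨i, j, s⟩) hs
    -- Both functionals have last coefficient `1`, so they agree on the normal of the hyperplane at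
    -- infinity.
    · simp [generator, functional_apply]
    · simp only [coneIndex, Finset.some_mem_insertNone, Finset.mem_sigma, Finset.mem_univ,
        Finset.mem_Ioi, Finset.mem_Icc, true_and] at hs
      simp only [generator, map_smul, smul_eq_mul, functional_coneNormal]
      exact (sign_mul_iff (hw i j s)).2 (h i j hs.1 s hs.2.1 hs.2.2)

theorem stepOrderLE_of_signLE {d : ℕ} {lam : Fin d → ℕ} {a b : Fin d → ℝ}
    (h : SignLE lam b a) : StepOrderLE lam (fun i => 2 * a i) (fun i => 2 * b i) := by
  intro i j k l hk1 hk hl1 hl hle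
  simp only at hle ⊢
  rcases lt_trichotomy i j with hij | rfl | hij
  · have := (h i j hij ((l : ℤ) - k) (by omega) (by omega)).2 (by push_cast; linarith)
    push_cast at this
    linarith
  · linarith
  · have := (h j i hij ((k : ℤ) - l) (by omega) (by omega)).1 (by push_cast; linarith)
    push_cast at this
    linarith

/-- One of the two steps can be taken to be a first step, the other absorbing `s`. -/
theorem exists_step_pair {p q : ℕ} {s : ℤ} (hp : 0 < p) (hq : 0 < q) (h1 : -(p : ℤ) + 1 ≤ s)
    (h2 : s ≤ (q : ℤ) - 1) :
    ∃ k l : ℕ, 1 ≤ k ∧ k ≤ p ∧ 1 ≤ l ∧ l ≤ q ∧ (l : ℝ) - k = s := by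
  have key : ∃ k l : ℕ, 1 ≤ k ∧ k ≤ p ∧ 1 ≤ l ∧ l ≤ q ∧ (l : ℤ) - k = s := by
    rcases le_total 0 s with h | h
    · exact ⟨1, (1 + s).toNat, by omega, by omega, by omega, by omega, by omega⟩
    · exact ⟨(1 - s).toNat, 1, by omega, by omega, by omega, by omega, by omega⟩
  obtain ⟨k, l, hk1, hk, hl1, hl, hs⟩ := key
  exact ⟨k, l, hk1, hk, hl1, hl, by exact_mod_cast hs⟩

/-! ### Perturbation -/

/-- Sign conditions that are strict at `a` persist near `a`. -/
theorem eventually_strict {d : ℕ} (lam : Fin d → ℕ) (a : Fin d → ℝ) :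
    ∀ᶠ b in 𝓝 a, ∀ i j : Fin d, ∀ s ∈ Finset.Icc (-(lam i : ℤ) + 1) ((lam j : ℤ) - 1),
      (0 < a i - a j - (s : ℝ) → 0 < b i - b j - (s : ℝ)) ∧
        (a i - a j - (s : ℝ) < 0 → b i - b j - (s : ℝ) < 0) := by
  rw [eventually_all]
  intro i
  rw [eventually_all]
  intro j
  rw [Filter.eventually_all_finset]
  intro s _
  have hc : Continuous fun b : Fin d → ℝ => b i - b j - s := by fun_prop
  refine Filter.Eventually.and ?_ ?_
  · by_cases h : 0 < a i - a j - s
    · exact (hc.continuousAt.eventually (lt_mem_nhds h)).mono fun _ h' _ => h'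
    · exact Eventually.of_forall fun _ h' => absurd h' h
  · by_cases h : a i - a j - s < 0
    · exact (hc.continuousAt.eventually (gt_mem_nhds h)).mono fun _ h' _ => h'
    · exact Eventually.of_forall fun _ h' => absurd h' h

theorem eventually_signLE {d : ℕ} (lam : Fin d → ℕ) (a : Fin d → ℝ) :
    ∀ᶠ b in 𝓝 a, SignLE lam a b := by
  filter_upwards [eventually_strict lam a] with b hb i j _ s h1 h2
  obtain ⟨h3, h4⟩ := hb i j s (Finset.mem_Icc.2 ⟨h1, h2⟩)
  exact ⟨fun h => not_lt.1 fun h' => h.not_gt (h4 h'), fun h => not_lt.1 fun h' => h.not_gt (h3 h')⟩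

/-- `a` lies on no hyperplane of the arrangement. -/
def IsGeneric {d : ℕ} (lam : Fin d → ℕ) (a : Fin d → ℝ) : Prop :=
  ∀ i j : Fin d, i < j → ∀ s : ℤ, -(lam i : ℤ) + 1 ≤ s → s ≤ (lam j : ℤ) - 1 → a i - a j - s ≠ 0

theorem compl_sUnion_deformedBraid {d : ℕ} (lam : Fin d → ℕ) :
    (⋃₀ deformedBraid lam)ᶜ = {a | IsGeneric lam a} := by
  ext a
  simp only [Set.mem_compl_iff, Set.mem_sUnion, Set.mem_ofPred_eq, IsGeneric]
  constructor
  · intro h i j hij s h1 h2 h3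
    exact h ⟨_, ⟨i, j, hij, s, h1, h2, rfl⟩, by simpa [sub_eq_zero] using h3⟩
  · rintro h ⟨_, ⟨i, j, hij, s, h1, h2, rfl⟩, h3⟩
    exact h i j hij s h1 h2 (sub_eq_zero.2 h3)

theorem IsGeneric.eventually_signLE {d : ℕ} {lam : Fin d → ℕ} {a : Fin d → ℝ}
    (ha : IsGeneric lam a) : ∀ᶠ b in 𝓝 a, SignLE lam b a := by
  filter_upwards [eventually_strict lam a] with b hb i j hij s h1 h2
  obtain ⟨h3, h4⟩ := hb i j s (Finset.mem_Icc.2 ⟨h1, h2⟩)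
  have h0 := ha i j hij s h1 h2
  exact ⟨fun h => (h3 (lt_of_le_of_ne h h0.symm)).le, fun h => (h4 (lt_of_le_of_ne h h0)).le⟩

theorem exists_pos_of_eventually {d : ℕ} {a : Fin d → ℝ} {p : (Fin d → ℝ) → Prop}
    (h : ∀ᶠ b in 𝓝 a, p b) (u : Fin d → ℝ) : ∃ ε : ℝ, 0 < ε ∧ p (a + ε • u) := by
  have hc : Continuous fun ε : ℝ => a + ε • u := by fun_prop
  have h1 : Tendsto (fun ε : ℝ => a + ε • u) (𝓝[>] 0) (𝓝 a) := by
    have := hc.tendsto 0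
    rw [zero_smul, add_zero] at this
    exact this.mono_left nhdsWithin_le_nhds
  obtain ⟨ε, h2, h3⟩ := ((h1.eventually h).and self_mem_nhdsWithin).exists
  exact ⟨ε, h3, h2⟩

/-- Inclusion of lower faces of the path polytope in terms of sign vectors. -/
theorem face_pathPolytope_subset_iff {d : ℕ} {lam : Fin d → ℕ} (hlam : ∀ i, 0 < lam i)
    (hn : 0 < ∑ i, lam i) (a b : Fin d → ℝ) :
    face (functional fun i => 2 * a i) (pathPolytope lam) ⊆
      face (functional fun i => 2 * b i) (pathPolytope lam) ↔ SignLE lam b a := by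
  refine ⟨fun h => ?_, fun h => face_pathPolytope_subset hn (stepOrderLE_of_signLE h)⟩
  -- The separation lemma needs a strict inequality of costs. A small perturbation `e` of `a` breaks
  -- the tie in the wanted direction, and its face is still inside that of `b`.
  have hsub : ∀ {e : Fin d → ℝ}, SignLE lam a e →
      face (functional fun i => 2 * e i) (pathPolytope lam) ⊆
        face (functional fun i => 2 * b i) (pathPolytope lam) := fun he =>
    (face_pathPolytope_subset hn (stepOrderLE_of_signLE he)).trans h
  intro i j hij s h1 h2
  obtain ⟨k, l, hk1, hk, hl1, hl, hs⟩ := exists_step_pair (hlam i) (hlam j) h1 h2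
  constructor
  · intro h0
    obtain ⟨ε, hε, he⟩ := exists_pos_of_eventually (eventually_signLE lam a) (Pi.single i 1)
    have := step_le_of_face_subset hn (hsub he) (i := j) (j := i) hl1 hl hk1 hk (by
      simp [hij.ne']
      linarith)
    linarith
  · intro h0
    obtain ⟨ε, hε, he⟩ := exists_pos_of_eventually (eventually_signLE lam a) (Pi.single j 1)
    have := step_le_of_face_subset hn (hsub he) (i := i) (j := j) hk1 hk hl1 hl (by
      simp [hij.ne]
      linarith)
    linarith

/-! ### The posets of lower faces -/

theorem exists_eq_smul_functional {d : ℕ} (c : Space d →ₗ[ℝ] ℝ) (hc : 0 < c (0, 1)) :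
    ∃ a : Fin d → ℝ, c = c (0, 1) • functional a := by
  refine ⟨fun i => c (Pi.single i 1, 0) / c (0, 1), ?_⟩
  refine LinearMap.prod_ext (LinearMap.pi_ext' fun i => LinearMap.ext_ring ?_)
    (LinearMap.ext_ring ?_)
  · simp [functional_apply, Pi.single_apply, mul_div_cancel₀ _ hc.ne']
  · simp [functional_apply]

theorem face_smul {E : Type*} [AddCommGroup E] [Module ℝ E] {r : ℝ} (hr : 0 < r)
    (c : E →ₗ[ℝ] ℝ) (P : Set E) : face (r • c) P = face c P := by
  simp [face, mul_le_mul_iff_right₀ hr]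

theorem lowerFaces_eq_range {d : ℕ} {P : Set (Space d)}
    (hP : ∀ a, (face (functional a) P).Nonempty) :
    lowerFaces P = Set.range fun a => face (functional a) P := by
  ext F
  constructor
  · rintro ⟨-, c, hc, rfl⟩
    obtain ⟨a, ha⟩ := exists_eq_smul_functional c hc
    refine ⟨a, ?_⟩
    change face (functional a) P = face c P
    rw [ha, face_smul hc]
  · rintro ⟨a, rfl⟩
    exact ⟨hP a, functional a, by simp [functional_apply], rfl⟩

theorem lowerFaces_eq_range_two_mul {d : ℕ} {P : Set (Space d)}
    (hP : ∀ a, (face (functional a) P).Nonempty) :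
    lowerFaces P = Set.range fun a : Fin d → ℝ => face (functional fun i => 2 * a i) P := by
  rw [lowerFaces_eq_range hP]
  ext F
  constructor
  · rintro ⟨a, rfl⟩
    refine ⟨fun i => a i / 2, ?_⟩
    simp [mul_div_cancel₀]
  · rintro ⟨a, rfl⟩
    exact ⟨_, rfl⟩

/-- Two families that induce the same preorder have isomorphic ranges. -/
theorem nonempty_orderIso_range {α β γ : Type*} [PartialOrder β] [PartialOrder γ] {f : α → β}
    {g : α → γ} (h : ∀ a b, f a ≤ f b ↔ g a ≤ g b) : Nonempty (Set.range f ≃o Set.range g) := by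
  choose p hp using fun x : Set.range f => x.2
  let φ : Set.range f → Set.range g := fun x => ⟨g (p x), p x, rfl⟩
  have hφ : ∀ x y, φ x ≤ φ y ↔ x ≤ y := fun x y => by
    rw [← Subtype.coe_le_coe, ← Subtype.coe_le_coe, ← hp x, ← hp y]
    exact (h _ _).symm
  have hsurj : Function.Surjective φ := by
    rintro ⟨_, a, rfl⟩
    refine ⟨⟨f a, a, rfl⟩, Subtype.ext ?_⟩
    have := hp ⟨f a, a, rfl⟩
    exact le_antisymm ((h _ _).1 this.le) ((h _ _).1 this.ge)
  exact ⟨RelIso.ofSurjective (OrderEmbedding.ofMapLEIff φ hφ) hsurj⟩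

/-- Two maps with the same kernel have equinumerous ranges. -/
theorem nonempty_equiv_range {α β γ : Type*} {f : α → β} {g : α → γ}
    (h : ∀ a b, f a = f b ↔ g a = g b) : Nonempty (Set.range f ≃ Set.range g) := by
  have hk : Setoid.ker f = Setoid.ker g := Setoid.ext h
  exact ⟨(Setoid.quotientKerEquivRange f).symm.trans
    ((Quotient.congrRight h).trans (Setoid.quotientKerEquivRange g))⟩

/-! ### Lower vertices and regions -/

theorem SignLE.symm_of_isGeneric {d : ℕ} {lam : Fin d → ℕ} {a b : Fin d → ℝ}
    (hb : IsGeneric lam b) (h : SignLE lam b a) : SignLE lam a b := by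
  intro i j hij s h1 h2
  have h0 := hb i j hij s h1 h2
  obtain ⟨h3, h4⟩ := h i j hij s h1 h2
  exact ⟨fun h5 => not_lt.1 fun h6 => h0 (le_antisymm (h4 h6.le) h5),
    fun h5 => not_lt.1 fun h6 => h0 (le_antisymm h5 (h3 h6.le))⟩

/-- On a component no `x i - x j - s` vanishes, so its sign is constant; conversely, the segment
between points with equal signs misses every hyperplane. -/
theorem connectedComponentIn_eq_iff {d : ℕ} {lam : Fin d → ℕ} {a b : Fin d → ℝ}
    (ha : IsGeneric lam a) (hb : IsGeneric lam b) :
    connectedComponentIn {x | IsGeneric lam x} a = connectedComponentIn {x | IsGeneric lam x} b ↔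
      SignLE lam b a := by
  constructor
  · intro h i j hij s h1 h2
    set C := connectedComponentIn {x | IsGeneric lam x} a with hC
    have hpre : IsPreconnected C := isPreconnected_connectedComponentIn
    have haC : a ∈ C := mem_connectedComponentIn ha
    have hbC : b ∈ C := h ▸ mem_connectedComponentIn hb
    have hcont : ContinuousOn (fun x : Fin d → ℝ => x i - x j - s) C := by fun_prop
    have hne : ∀ x ∈ C, x i - x j - s ≠ 0 := fun x hx =>
      connectedComponentIn_subset _ _ hx i j hij s h1 h2
    constructor
    · intro h3
      by_contra! h4
      obtain ⟨x, hx, hx0⟩ := hpre.intermediate_value hbC haC hcont ⟨h4.le, h3⟩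
      exact hne x hx hx0
    · intro h3
      by_contra! h4
      obtain ⟨x, hx, hx0⟩ := hpre.intermediate_value haC hbC hcont ⟨h3, h4.le⟩
      exact hne x hx hx0
  · intro h
    refine connectedComponentIn_eq ?_
    refine (convex_segment a b).isPreconnected.subset_connectedComponentIn
      (left_mem_segment ℝ a b) ?_ (right_mem_segment ℝ a b)
    rintro _ ⟨u, v, hu, hv, huv, rfl⟩ i j hij s h1 h2
    have e : (u • a + v • b) i - (u • a + v • b) j - s =
        u * (a i - a j - s) + v * (b i - b j - s) := by
      simp only [Pi.add_apply, Pi.smul_apply, smul_eq_mul]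
      linear_combination -(s : ℝ) * huv.symm
    rw [e]
    have ha0 := ha i j hij s h1 h2
    have hb0 := hb i j hij s h1 h2
    obtain ⟨h3, h4⟩ := h i j hij s h1 h2
    rcases hu.eq_or_lt with rfl | hu'
    · have : v = 1 := by linarith
      simpa [this] using hb0
    · rcases ha0.lt_or_gt with h5 | h5
      · have := mul_neg_of_pos_of_neg hu' h5
        have := mul_nonpos_of_nonneg_of_nonpos hv (h4 h5.le)
        linarith
      · have := mul_pos hu' h5
        have := mul_nonneg hv (h3 h5.le)
        linarith

/-- The faces that are points are those of generic functionals. -/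
theorem exists_face_pathPolytope_eq_singleton_iff {d : ℕ} {lam : Fin d → ℕ}
    (hlam : ∀ i, 0 < lam i) (hn : 0 < ∑ i, lam i) (a : Fin d → ℝ) :
    (∃ z, face (functional fun i => 2 * a i) (pathPolytope lam) = {z}) ↔ IsGeneric lam a := by
  constructor
  · rintro ⟨z, hz⟩ i j hij s h1 h2 h0
    -- Moving off the hyperplane gives a nonempty face inside a point, hence the same face and so
    -- the same signs, a contradiction.
    obtain ⟨ε, hε, he⟩ := exists_pos_of_eventually (eventually_signLE lam a) (Pi.single i 1)
    have hsub := (face_pathPolytope_subset_iff hlam hn _ _).2 he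
    have hne : (face (functional fun k => 2 * (a + ε • Pi.single i 1 : Fin d → ℝ) k)
        (pathPolytope lam)).Nonempty := ⟨_, average_greedySection_mem hn _⟩
    rw [hz, hne.subset_singleton_iff] at hsub
    have hsub' := (face_pathPolytope_subset_iff hlam hn _ _).1 (hz.trans hsub.symm).subset
    have := (hsub' i j hij s h1 h2).2 h0.le
    simp [hij.ne'] at this
    linarith
  · intro ha
    refine ⟨_, Set.eq_singleton_iff_unique_mem.2 ⟨average_greedySection_mem hn _, fun y hy => ?_⟩⟩
    set z := average (liftedPile lam) (coordSum d) (greedySection lam fun i => 2 * a i)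
    have hz : z ∈ face (functional fun i => 2 * a i) (pathPolytope lam) :=
      average_greedySection_mem hn _
    have e1 := le_antisymm (hy.2 z hz.1) (hz.2 y hy.1)
    -- A generic `a` can be moved slightly along each axis with its face still minimal, so `y` and
    -- `z` agree under both functionals and hence in that coordinate.
    have hfst : y.1 = z.1 := by
      funext i
      obtain ⟨ε, hε, he⟩ := exists_pos_of_eventually ha.eventually_signLE (Pi.single i 1)
      have hsub := (face_pathPolytope_subset_iff hlam hn _ _).2 he
      have e2 := le_antisymm ((hsub hy).2 z hz.1) ((hsub hz).2 y hy.1)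
      simp only [functional_apply, Pi.add_apply, Pi.smul_apply, smul_eq_mul, mul_add, add_mul,
        Finset.sum_add_distrib, Pi.single_apply, mul_ite, mul_one, mul_zero, ite_mul, zero_mul,
        Finset.sum_ite_eq', Finset.mem_univ, if_true] at e1 e2
      have e3 : 2 * ε * y.1 i = 2 * ε * z.1 i := by linarith
      exact mul_left_cancel₀ (by positivity) e3
    rw [functional_apply, functional_apply, hfst] at e1
    exact Prod.ext hfst (by linarith)

theorem lowerVertices_equiv_range {d : ℕ} (P : Set (Space d)) :
    Nonempty (lowerVertices P ≃ {F | F ∈ lowerFaces P ∧ ∃ z, F = {z}}) :=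
  ⟨Equiv.ofBijective (fun v => ⟨{v.1}, v.2, v.1, rfl⟩)
    ⟨fun v w h => Subtype.ext (Set.singleton_injective (congrArg Subtype.val h)), by
      rintro ⟨_, h, z, rfl⟩
      exact ⟨⟨z, h⟩, rfl⟩⟩⟩

theorem sum_lam_pos {d : ℕ} (hd : 0 < d) {lam : Fin d → ℕ} (hlam : ∀ i, 0 < lam i) :
    0 < ∑ i, lam i :=
  Finset.sum_pos (fun i _ => hlam i) ⟨⟨0, hd⟩, Finset.mem_univ _⟩

theorem face_pathPolytope_nonempty {d : ℕ} {lam : Fin d → ℕ} (hn : 0 < ∑ i, lam i)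
    (a : Fin d → ℝ) : (face (functional a) (pathPolytope lam)).Nonempty :=
  ⟨_, average_greedySection_mem hn a⟩

theorem nonempty_lowerFaces_orderIso {d : ℕ} {lam : Fin d → ℕ} (hlam : ∀ i, 0 < lam i)
    (hn : 0 < ∑ i, lam i) (w₀ : ℝ) {w : Fin d → Fin d → ℤ → ℝ} (hw : ∀ i j s, w i j s ≠ 0) :
    Nonempty (lowerFaces (pathPolytope lam) ≃o lowerFaces (polarZonotope lam w₀ w)) := by
  rw [lowerFaces_eq_range_two_mul (face_pathPolytope_nonempty hn), lowerFaces_eq_range fun a => by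
    rw [polarZonotope_eq]; exact face_zonotope_nonempty _ _ _]
  exact nonempty_orderIso_range fun a b =>
    (face_pathPolytope_subset_iff hlam hn a b).trans
      (face_polarZonotope_subset_iff lam hw a b).symm

theorem nonempty_lowerVertices_equiv {d : ℕ} {lam : Fin d → ℕ} (hlam : ∀ i, 0 < lam i)
    (hn : 0 < ∑ i, lam i) :
    Nonempty (lowerVertices (pathPolytope lam) ≃ regions (deformedBraid lam)) := by
  obtain ⟨e₁⟩ := lowerVertices_equiv_range (pathPolytope lam)
  have h₁ : {F | F ∈ lowerFaces (pathPolytope lam) ∧ ∃ z, F = {z}} =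
      Set.range fun a : {a // IsGeneric lam a} =>
        face (functional fun i => 2 * a.1 i) (pathPolytope lam) := by
    rw [lowerFaces_eq_range_two_mul (face_pathPolytope_nonempty hn)]
    ext F
    constructor
    · rintro ⟨⟨a, rfl⟩, hz⟩
      exact ⟨⟨a, (exists_face_pathPolytope_eq_singleton_iff hlam hn a).1 hz⟩, rfl⟩
    · rintro ⟨a, rfl⟩
      exact ⟨⟨a.1, rfl⟩, (exists_face_pathPolytope_eq_singleton_iff hlam hn a.1).2 a.2⟩
  have h₂ : regions (deformedBraid lam) = Set.range fun a : {a // IsGeneric lam a} =>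
      connectedComponentIn {x | IsGeneric lam x} a.1 := by
    ext R
    rw [regions, compl_sUnion_deformedBraid]
    constructor
    · rintro ⟨x, hx, rfl⟩
      exact ⟨⟨x, hx⟩, rfl⟩
    · rintro ⟨x, rfl⟩
      exact ⟨x.1, x.2, rfl⟩
  have h₃ : ∀ a b : {a // IsGeneric lam a},
      face (functional fun i => 2 * a.1 i) (pathPolytope lam) =
        face (functional fun i => 2 * b.1 i) (pathPolytope lam) ↔
      connectedComponentIn {x | IsGeneric lam x} a.1 =
        connectedComponentIn {x | IsGeneric lam x} b.1 := fun a b => by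
    rw [connectedComponentIn_eq_iff a.2 b.2, Set.Subset.antisymm_iff,
      face_pathPolytope_subset_iff hlam hn, face_pathPolytope_subset_iff hlam hn]
    exact ⟨fun h => h.1, fun h => ⟨h, h.symm_of_isGeneric b.2⟩⟩
  obtain ⟨e₂⟩ := nonempty_equiv_range h₃
  rw [h₂]
  exact ⟨e₁.trans ((Equiv.setCongr h₁).trans e₂)⟩

end MonotonePath

end

theorem corollary2p2 {d : ℕ} (hd : 0 < d) (lam : Fin d → ℕ) (hlam : ∀ i, 0 < lam i) :
    (∀ (w₀ : ℝ) (w : Fin d → Fin d → ℤ → ℝ), w₀ ≠ 0 → (∀ i j s, w i j s ≠ 0) →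
      Nonempty (MonotonePath.lowerFaces (MonotonePath.pathPolytope lam) ≃o
        MonotonePath.lowerFaces (MonotonePath.polarZonotope lam w₀ w))) ∧
    Nonempty (MonotonePath.lowerVertices (MonotonePath.pathPolytope lam) ≃
      MonotonePath.regions (MonotonePath.deformedBraid lam)) := by
  have hn := MonotonePath.sum_lam_pos hd hlam
  exact ⟨fun w₀ _ _ hw => MonotonePath.nonempty_lowerFaces_orderIso hlam hn w₀ hw,
    MonotonePath.nonempty_lowerVertices_equiv hlam hn⟩
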